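/- Let $k$ be a field of characteristic $0$ and $\lambda\in k$. A (left) pre-Lie algebra is a $k$-vector space $\mathfrak g$ with a bilinear product $\cdot$ such that $(x\cdot y)\cdot z-x\cdot(y\cdot z)=(y\cdot x)\cdot z-y\cdot(x\cdot z)$; put $[x,y]=x\cdot y-y\cdot x$. A bimodule over it is a vector space $M$ with bilinear actions $x\cdot u$, $u\cdot x$ such that $x\cdot(y\cdot u)-(x\cdot y)\cdot u=y\cdot(x\cdot u)-(y\cdot x)\cdot u$ and $x\cdot(u\cdot y)-(x\cdot u)\cdot y=u\cdot(x\cdot y)-(u\cdot x)\cdot y$. Its cochain complex $C^\bullet_{PLA}(\mathfrak g,M)$ has $C^n=\mathrm{Hom}(\wedge^{n-1}\mathfrak g\otimes\mathfrak g,M)$ for $n\ge 1$, with differential $$(\partial^n f)(x_1,\dots,x_{n+1})=\sum_{i=1}^n(-1)^{i+1}\Big(x_i\cdot f(\dots,\hat x_i,\dots,x_{n+1})+f(\dots,\hat x_i,\dots,x_n,x_i)\cdot x_{n+1}-f(\dots,\hat x_i,\dots,x_n,x_i\cdot x_{n+1})\Big)+\sum_{1\le i<j\le n}(-1)^{i+j}f([x_i,x_j],x_1,\dots,\hat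 x_i,\dots,\hat x_j,\dots,x_{n+1}).$$ Let $T:\mathfrak g\to\mathfrak g$ be a Rota-Baxter operator of weight $\lambda$, that is, a linear map with $T(a)\cdot T(b)=T(a\cdot T(b)+T(a)\cdot b+\lambda\,a\cdot b)$, and let $(M,T_M)$ be a Rota-Baxter bimodule, that is, a bimodule $M$ with a linear map $T_M:M\to M$ such that $T(a)\cdot T_M(m)=T_M(a\cdot T_M(m)+T(a)\cdot m+\lambda\,a\cdot m)$ and $T_M(m)\cdot T(a)=T_M(m\cdot T(a)+T_M(m)\cdot a+\lambda\,m\cdot a)$. Let $\mathfrak g_\star$ be the pre-Lie algebra $\mathfrak g$ with product $a\star b=a\cdot T(b)+T(a)\cdot b+\lambda\,a\cdot b$, let ${}_\rhd M_\lhd$ be the $\mathfrak g_\star$-bimodule $M$ with actions $a\rhd m=T(a)\cdot m-T_M(a\cdot m)$ and $m\lhd a=m\cdot T(a)-T_M(m\cdot a)$, and let $C^\bullet_{RBO}(\mathfrak g,M)=C^\bullet_{PLA}(\mathfrak g_\star,{}_\rhd M_\lhd)$. For $n\ge 1$ and $f\in C^n_{PLA}(\mathfrak g,M)$ define $\Phi^n(f)\in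 C^n_{RBO}(\mathfrak g,M)$ by $$\Phi^n(f)(x_1,\dots,x_n)=f(T(x_1),\dots,T(x_n))-\sum_{k=1}^{n}\lambda^{n-k}\sum_{S\subseteq\{1,\dots,n-1\},\,|S|=k-1}T_M\big(f(x^S_1,\dots,x^S_{n-1},x_n)\big)-\sum_{k=2}^{n}\lambda^{n-k}\sum_{S\subseteq\{1,\dots,n-1\},\,|S|=k-2}T_M\big(f(x^S_1,\dots,x^S_{n-1},T(x_n))\big),$$ where $x^S_i=T(x_i)$ for $i\in S$ and $x^S_i=x_i$ for $i\notin S$ (and $\lambda^0=1$). Then the linear maps $\Phi^n$ form a morphism of cochain complexes $\Phi^\bullet:C^\bullet_{PLA}(\mathfrak g,M)\to C^\bullet_{RBO}(\mathfrak g,M)$; that is, $\partial^n_{RBO}\,\Phi^n=\Phi^{n+1}\,\partial^n_{PLA}$ for all $n\ge 1$. -/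

import Mathlib

open Finset

universe u v w

namespace RotaBaxterPreLie

/-- A bimodule (representation) `M` over the pre-Lie algebra `A`: a left action `left x u = x · u`
and a right action `right u y = u · y`, subject to the two compatibility conditions. -/
structure Bimodule (K A M : Type*) [Field K] [LeftPreLieRing A] [LeftPreLieAlgebra K A]
    [AddCommGroup M] [Module K M] where
  left : A →ₗ[K] M →ₗ[K] M
  right : M →ₗ[K] A →ₗ[K] M
  left_left : ∀ (x y : A) (u : M),
    left x (left y u) - left (x * y) u = left y (left x u) - left (y * x) u
  left_right : ∀ (x y : A) (u : M),
    left x (right u y) - right (left x u) y = right u (x * y) - right (right u x) y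

/-- A Rota-Baxter operator of weight `lam` on the pre-Lie algebra `A`. -/
structure RBOperator (K A : Type*) [Field K] [LeftPreLieRing A] [LeftPreLieAlgebra K A]
    (lam : K) where
  op : A →ₗ[K] A
  rota_baxter : ∀ a b : A, op a * op b = op (a * op b + op a * b + lam • (a * b))

/-- A Rota-Baxter bimodule over the Rota-Baxter pre-Lie algebra `(A, T)` of weight `lam`. -/
structure RBBimodule {K A : Type*} [Field K] [LeftPreLieRing A] [LeftPreLieAlgebra K A]
    {lam : K} (T : RBOperator K A lam) (M : Type*) [AddCommGroup M] [Module K M]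
    extends Bimodule K A M where
  opM : M →ₗ[K] M
  rota_baxter_left : ∀ (a : A) (m : M),
    left (T.op a) (opM m) = opM (left a (opM m) + left (T.op a) m + lam • left a m)
  rota_baxter_right : ∀ (a : A) (m : M),
    right (opM m) (T.op a) = opM (right m (T.op a) + right (opM m) a + lam • right m a)

section Complex

variable {K A M : Type*} [Field K] [LeftPreLieRing A] [LeftPreLieAlgebra K A]
  [AddCommGroup M] [Module K M]

variable (K A M) in
/-- `Cochain K A M n` is the space `Hom (⋀ⁿ A ⊗ A, M)` of `(n + 1)`-cochains: maps that are
alternating in the first `n` arguments and linear in the last one. -/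
abbrev Cochain (n : ℕ) : Type _ := A [⋀^Fin n]→ₗ[K] (A →ₗ[K] M)

/-- The map `x ↦ φ ↦ (y ↦ x · φ y + φ x · y - φ (x · y))`. -/
def Bimodule.homAction (B : Bimodule K A M) : A →ₗ[K] (A →ₗ[K] M) →ₗ[K] (A →ₗ[K] M) :=
  LinearMap.mk₂ K
    (fun x φ => B.left x ∘ₗ φ + B.right (φ x) - φ ∘ₗ LinearMap.mulLeft K x)
    (fun x x' φ => by ext y; simp [add_mul]; abel)
    (fun c x φ => by ext y; simp [smul_mul_assoc, smul_add, smul_sub])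
    (fun x φ φ' => by ext y; simp; abel)
    (fun c x φ => by ext y; simp [smul_add, smul_sub])

@[simp]
theorem Bimodule.homAction_apply (B : Bimodule K A M) (x : A) (φ : A →ₗ[K] M) (y : A) :
    B.homAction x φ y = B.left x (φ y) + B.right (φ x) y - φ (x * y) := by
  simp [Bimodule.homAction]

theorem Bimodule.homAction_lie (B : Bimodule K A M) (x y : A) (φ : A →ₗ[K] M) :
    B.homAction ⁅x, y⁆ φ
      = B.homAction x (B.homAction y φ) - B.homAction y (B.homAction x φ) := by
  ext z
  have h1 := B.left_left x y (φ z)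
  have h2 := B.left_right x z (φ y)
  have h3 := B.left_right y z (φ x)
  have h4 := congrArg φ (LeftPreLieRing.assoc_symm x y z)
  simp only [associator, map_sub] at h4
  simp only [Bimodule.homAction_apply, Ring.lie_def, map_sub, map_add, LinearMap.sub_apply,
    LinearMap.add_apply]
  linear_combination (norm := module) -h1 - h2 + h3 - h4

/-- The part of the differential that contains the brackets
`[x_i, x_j] = x_i · x_j - x_j · x_i`, see `lieDiff_apply_succ`. -/
def bracketPart : {n : ℕ} → Cochain K A M n → Cochain K A M (n + 1)
  | 0, _ => 0
  | _ + 1, f => -AlternatingMap.alternatizeUncurryFin (AlternatingMap.alternatizeUncurryFinLM ∘ₗ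
      (LinearMap.mul K A).compr₂ f.curryLeft)

/-- Here a pair of indices `i ≤ j` stands for the pair of positions `i < j + 1` in the tuple `x`,
and `j.removeNth (i.castSucc.removeNth x)` is `x` with the entries at these positions omitted. -/
theorem bracketPart_apply_succ {n : ℕ} (f : Cochain K A M (n + 1)) (x : Fin (n + 2) → A) :
    bracketPart f x = ∑ i : Fin (n + 1), ∑ j ≥ i, (-1 : ℤ) ^ (i + (j + 1) : ℕ) •
      f (Matrix.vecCons ⁅x i.castSucc, x j.succ⁆ (j.removeNth (i.castSucc.removeNth x))) := by
  simp only [bracketPart, AlternatingMap.neg_apply,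
    AlternatingMap.alternatizeUncurryFin_alternatizeUncurryFinLM_comp_apply]
  rw [← Finset.sum_neg_distrib]
  refine Finset.sum_congr rfl fun i _ => ?_
  rw [← Finset.sum_neg_distrib]
  refine Finset.sum_congr rfl fun j _ => ?_
  rw [Ring.lie_def, ← add_assoc, pow_succ, mul_neg_one, neg_smul]
  congr 2
  simp only [← AlternatingMap.curryLeft_apply_apply, map_sub, AlternatingMap.sub_apply]
  simp

/-- The differential of the pre-Lie cochain complex, from `(n + 1)`-cochains to
`(n + 2)`-cochains; the explicit formula is `diff_apply_zero` and `diff_apply_succ`. -/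
def Bimodule.diff (B : Bimodule K A M) {n : ℕ} (f : Cochain K A M n) : Cochain K A M (n + 1) :=
  AlternatingMap.alternatizeUncurryFin
    { toFun := fun x => (B.homAction x).compAlternatingMap f
      map_add' := fun x x' => by ext; simp
      map_smul' := fun c x => by ext; simp } + bracketPart f

theorem Bimodule.diff_apply (B : Bimodule K A M) {n : ℕ} (f : Cochain K A M n)
    (x : Fin (n + 1) → A) :
    B.diff f x = ∑ i : Fin (n + 1), (-1 : ℤ) ^ (i : ℕ) • B.homAction (x i) (f (i.removeNth x))
      + bracketPart f x := by
  simp only [Bimodule.diff, AlternatingMap.add_apply, AlternatingMap.alternatizeUncurryFin_apply]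
  rfl

theorem Bimodule.diff_apply_zero (B : Bimodule K A M) (f : Cochain K A M 0)
    (x : Fin 1 → A) (y : A) :
    B.diff f x y = B.left (x 0) (f ![] y) + B.right (f ![] (x 0)) y - f ![] (x 0 * y) := by
  rw [Bimodule.diff_apply]
  simp [bracketPart, Subsingleton.elim (Fin.tail x) ![]]

theorem Bimodule.diff_apply_succ (B : Bimodule K A M) {n : ℕ} (f : Cochain K A M (n + 1))
    (x : Fin (n + 2) → A) (y : A) :
    B.diff f x y =
      ∑ i : Fin (n + 2), (-1 : ℤ) ^ (i : ℕ) • B.left (x i) (f (i.removeNth x) y)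
      + ∑ i : Fin (n + 2), (-1 : ℤ) ^ (i : ℕ) • B.right (f (i.removeNth x) (x i)) y
      - ∑ i : Fin (n + 2), (-1 : ℤ) ^ (i : ℕ) • f (i.removeNth x) (x i * y)
      + ∑ i : Fin (n + 1), ∑ j ≥ i, (-1 : ℤ) ^ (i + (j + 1) : ℕ) •
          f (Matrix.vecCons ⁅x i.castSucc, x j.succ⁆ (j.removeNth (i.castSucc.removeNth x))) y := by
  rw [Bimodule.diff_apply, bracketPart_apply_succ]
  simp only [LinearMap.add_apply, LinearMap.sum_apply, LinearMap.smul_apply,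
    Bimodule.homAction_apply, smul_add, smul_sub, Finset.sum_add_distrib, Finset.sum_sub_distrib]

theorem Bimodule.diff_add (B : Bimodule K A M) {n : ℕ} (f g : Cochain K A M n) :
    B.diff (f + g) = B.diff f + B.diff g := by
  ext x y
  cases n with
  | zero => simp only [Bimodule.diff_apply_zero, AlternatingMap.add_apply, LinearMap.add_apply,
      map_add]; abel
  | succ n =>
    simp only [Bimodule.diff_apply_succ, AlternatingMap.add_apply, LinearMap.add_apply, map_add,
      smul_add, Finset.sum_add_distrib]
    abel

theorem Bimodule.diff_smul (B : Bimodule K A M) {n : ℕ} (c : K) (f : Cochain K A M n) :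
    B.diff (c • f) = c • B.diff f := by
  ext x y
  cases n with
  | zero => simp [Bimodule.diff_apply_zero, smul_add, smul_sub]
  | succ n =>
    simp only [Bimodule.diff_apply_succ, AlternatingMap.smul_apply, LinearMap.smul_apply, map_smul,
      smul_add, smul_sub, Finset.smul_sum]
    simp only [smul_comm c]

/-- The Lie derivative on cochains. -/
def Bimodule.lieDer (B : Bimodule K A M) (a : A) {n : ℕ} (f : Cochain K A M n) :
    Cochain K A M n where
  toFun x := B.homAction a (f x) - ∑ i, f (Function.update x i ⁅a, x i⁆)
  map_update_add' := by
    intro _ x i u v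
    have e : ‹DecidableEq (Fin n)› = instDecidableEqFin n := Subsingleton.elim _ _
    subst e
    have key : ∀ w : A, ∑ k, f (Function.update (Function.update x i w) k
        ⁅a, Function.update x i w k⁆) = f (Function.update x i ⁅a, w⁆) +
          ∑ k ∈ univ.erase i, f (Function.update (Function.update x k ⁅a, x k⁆) i w) := by
      intro w
      rw [← Finset.add_sum_erase _ _ (mem_univ i)]
      congr 1
      · simp
      · refine Finset.sum_congr rfl fun k hk => ?_
        have hk : k ≠ i := Finset.ne_of_mem_erase hk
        rw [Function.update_of_ne hk, Function.update_comm hk]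
    simp only [key, lie_add, AlternatingMap.map_update_add, map_add, Finset.sum_add_distrib]
    abel
  map_update_smul' := by
    intro _ x i c u
    have e : ‹DecidableEq (Fin n)› = instDecidableEqFin n := Subsingleton.elim _ _
    subst e
    have key : ∀ w : A, ∑ k, f (Function.update (Function.update x i w) k
        ⁅a, Function.update x i w k⁆) = f (Function.update x i ⁅a, w⁆) +
          ∑ k ∈ univ.erase i, f (Function.update (Function.update x k ⁅a, x k⁆) i w) := by
      intro w
      rw [← Finset.add_sum_erase _ _ (mem_univ i)]
      congr 1
      · simp
      · refine Finset.sum_congr rfl fun k hk => ?_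
        have hk : k ≠ i := Finset.ne_of_mem_erase hk
        rw [Function.update_of_ne hk, Function.update_comm hk]
    simp only [key, lie_smul, AlternatingMap.map_update_smul, map_smul, smul_sub, smul_add,
      Finset.smul_sum]
  map_eq_zero_of_eq' := by
    intro x i j hx hij
    rw [f.map_eq_zero_of_eq x hx hij, map_zero, zero_sub, neg_eq_zero]
    rw [Fintype.sum_eq_add i j hij]
    · rw [← hx]
      have h := f.map_swap (Function.update x i ⁅a, x i⁆) hij
      have h2 : (Function.update x i ⁅a, x i⁆) ∘ Equiv.swap i j
          = Function.update x j ⁅a, x i⁆ := by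
        funext k
        by_cases hki : k = i
        · subst hki
          simp [Function.update_of_ne hij.symm, Function.update_of_ne hij, hx]
        · by_cases hkj : k = j
          · subst hkj; simp
          · simp [Equiv.swap_apply_of_ne_of_ne hki hkj, Function.update_of_ne hki,
              Function.update_of_ne hkj]
      rw [← h2, h, add_neg_cancel]
    · rintro k ⟨hki, hkj⟩
      refine f.map_eq_zero_of_eq _ ?_ hij
      rw [Function.update_of_ne hki.symm, Function.update_of_ne hkj.symm, hx]

theorem Bimodule.lieDer_apply (B : Bimodule K A M) (a : A) {n : ℕ} (f : Cochain K A M n)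
    (x : Fin n → A) :
    B.lieDer a f x = B.homAction a (f x) - ∑ i, f (Function.update x i ⁅a, x i⁆) := rfl

theorem curryLeft_lieDer (B : Bimodule K A M) (a b : A) {n : ℕ} (f : Cochain K A M (n + 1)) :
    (B.lieDer a f).curryLeft b = B.lieDer a (f.curryLeft b) - f.curryLeft ⁅a, b⁆ := by
  ext1 x
  simp only [AlternatingMap.curryLeft_apply_apply, AlternatingMap.sub_apply, B.lieDer_apply,
    Fin.sum_univ_succ, Matrix.vecCons, Fin.cons_zero, Fin.cons_succ, Fin.update_cons_zero,
    Fin.cons_update]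
  abel

theorem curryLeft_diff_zero (B : Bimodule K A M) (a : A) (f : Cochain K A M 0) :
    (B.diff f).curryLeft a = B.lieDer a f := by
  ext1 x
  rw [AlternatingMap.curryLeft_apply_apply, B.diff_apply, B.lieDer_apply]
  simp [bracketPart, Subsingleton.elim x ![]]

theorem removeNth_succ_vecCons {X : Type*} {n : ℕ} (a : X) (v : Fin (n + 1) → X)
    (i : Fin (n + 1)) :
    i.succ.removeNth (Matrix.vecCons a v : Fin (n + 2) → X)
      = Matrix.vecCons a (i.removeNth v) := by
  funext k
  refine Fin.cases ?_ (fun k => ?_) k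
  · simp [Fin.removeNth_apply]
  · simp [Fin.removeNth_apply]

theorem map_vecCons_vecCons {n : ℕ} (f : Cochain K A M (n + 2)) (a b : A) (v : Fin n → A) :
    f (Matrix.vecCons a (Matrix.vecCons b v)) = -f (Matrix.vecCons b (Matrix.vecCons a v)) := by
  rw [← f.map_swap (Matrix.vecCons b (Matrix.vecCons a v)) (i := 0) (j := 1) (by simp)]
  congr 1
  funext k
  refine Fin.cases ?_ (fun k => Fin.cases ?_ (fun k => ?_) k) k
  · simp
  · simp
  · rw [Function.comp_apply, Equiv.swap_apply_of_ne_of_ne]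
    · rfl
    · exact Fin.succ_ne_zero _
    · intro h
      exact Fin.succ_ne_zero k (Fin.succ_injective _ h)

theorem neg_one_smul_map_vecCons {n : ℕ} (f : Cochain K A M (n + 1)) (v : Fin (n + 1) → A)
    (a : A) (j : Fin (n + 1)) :
    (-1 : ℤ) ^ (j + 1 : ℕ) • f (Matrix.vecCons a (j.removeNth v)) = -f (Function.update v j a) := by
  rw [← Fin.insertNth_removeNth, AlternatingMap.map_insertNth, pow_succ, mul_neg_one, neg_smul]

theorem bracketPart_vecCons {n : ℕ} (f : Cochain K A M (n + 1)) (a : A) (v : Fin (n + 1) → A) :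
    bracketPart f (Matrix.vecCons a v) =
      -∑ j, f (Function.update v j ⁅a, v j⁆) - bracketPart (f.curryLeft a) v := by
  rw [bracketPart_apply_succ, Fin.sum_univ_succ, ← Finset.sum_neg_distrib, sub_eq_add_neg]
  congr 1
  · refine Finset.sum_congr (by ext; simp) fun j _ => ?_
    rw [← neg_one_smul_map_vecCons]
    simp only [Fin.castSucc_zero, Matrix.cons_val_zero, Matrix.cons_val_succ, Fin.val_zero,
      zero_add, Fin.removeNth_zero]
    rfl
  · cases n with
    | zero => simp [bracketPart]
    | succ n =>
      rw [bracketPart_apply_succ, ← Finset.sum_neg_distrib]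
      refine Finset.sum_congr rfl fun i _ => ?_
      rw [← Fin.map_succEmb_Ici, Finset.sum_map, ← Finset.sum_neg_distrib]
      refine Finset.sum_congr rfl fun j _ => ?_
      simp only [Fin.coe_succEmb, ← Fin.succ_castSucc, removeNth_succ_vecCons,
        Matrix.cons_val_succ, Fin.val_succ, AlternatingMap.curryLeft_apply_apply]
      rw [map_vecCons_vecCons, smul_neg, neg_inj]
      congr 1
      rw [add_right_comm (i : ℕ) 1 (j + 1 + 1), ← add_assoc, pow_succ, pow_succ]
      simp [pow_add, pow_succ]

theorem curryLeft_diff_succ (B : Bimodule K A M) (a : A) {n : ℕ} (f : Cochain K A M (n + 1)) :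
    (B.diff f).curryLeft a = B.lieDer a f - B.diff (f.curryLeft a) := by
  ext1 v
  simp only [AlternatingMap.curryLeft_apply_apply, AlternatingMap.sub_apply, B.diff_apply,
    B.lieDer_apply]
  rw [bracketPart_vecCons, Fin.sum_univ_succ]
  simp only [removeNth_succ_vecCons, Matrix.cons_val_zero, Matrix.cons_val_succ, Fin.val_succ,
    pow_succ, mul_neg_one, neg_smul, Finset.sum_neg_distrib, Fin.val_zero, pow_zero, one_smul,
    Fin.removeNth_zero]
  have : Fin.tail (Matrix.vecCons a v) = v := rfl
  rw [this]
  abel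

theorem Bimodule.lieDer_sub (B : Bimodule K A M) (a : A) {n : ℕ} (f g : Cochain K A M n) :
    B.lieDer a (f - g) = B.lieDer a f - B.lieDer a g := by
  ext1 x
  simp only [B.lieDer_apply, AlternatingMap.sub_apply, map_sub, Finset.sum_sub_distrib]
  abel

theorem Bimodule.diff_sub (B : Bimodule K A M) {n : ℕ} (f g : Cochain K A M n) :
    B.diff (f - g) = B.diff f - B.diff g := by
  refine eq_sub_of_add_eq ?_
  rw [← B.diff_add, sub_add_cancel]

theorem curryLeft_ext {n : ℕ} {f g : Cochain K A M (n + 1)}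
    (h : ∀ a, f.curryLeft a = g.curryLeft a) : f = g := by
  ext1 x
  have := congrArg (fun F => F (Matrix.vecTail x)) (h (Matrix.vecHead x))
  simpa using this

theorem curryLeft_sub' {n : ℕ} (f g : Cochain K A M (n + 1)) (a : A) :
    (f - g).curryLeft a = f.curryLeft a - g.curryLeft a := rfl

theorem Bimodule.lieDer_lie (B : Bimodule K A M) (a b : A) {n : ℕ} (f : Cochain K A M n) :
    B.lieDer ⁅a, b⁆ f = B.lieDer a (B.lieDer b f) - B.lieDer b (B.lieDer a f) := by
  induction n with
  | zero =>
    ext1 x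
    simp [B.lieDer_apply, B.homAction_lie]
  | succ n ih =>
    refine curryLeft_ext fun c => ?_
    simp only [curryLeft_lieDer, curryLeft_sub', ih, B.lieDer_sub]
    have : f.curryLeft ⁅⁅a, b⁆, c⁆ = f.curryLeft ⁅a, ⁅b, c⁆⁆ - f.curryLeft ⁅b, ⁅a, c⁆⁆ := by
      rw [← map_sub, lie_lie]
    rw [this]
    abel

theorem Bimodule.diff_lieDer (B : Bimodule K A M) (a : A) {n : ℕ} (f : Cochain K A M n) :
    B.diff (B.lieDer a f) = B.lieDer a (B.diff f) := by
  induction n with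
  | zero =>
    refine curryLeft_ext fun b => ?_
    rw [curryLeft_diff_zero, curryLeft_lieDer, curryLeft_diff_zero, curryLeft_diff_zero,
      B.lieDer_lie]
    abel
  | succ n ih =>
    refine curryLeft_ext fun b => ?_
    simp only [curryLeft_diff_succ, curryLeft_lieDer, B.lieDer_sub, B.diff_sub, ih, B.lieDer_lie]
    abel

theorem Bimodule.diff_diff (B : Bimodule K A M) {n : ℕ} (f : Cochain K A M n) :
    B.diff (B.diff f) = 0 := by
  induction n with
  | zero =>
    refine curryLeft_ext fun b => ?_
    rw [curryLeft_diff_succ, curryLeft_diff_zero, B.diff_lieDer, sub_self]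
    rfl
  | succ n ih =>
    refine curryLeft_ext fun b => ?_
    rw [curryLeft_diff_succ, curryLeft_diff_succ, B.diff_sub, ih, B.diff_lieDer]
    simp

/-- The differential as a linear map. -/
def Bimodule.diffLin (B : Bimodule K A M) (n : ℕ) : Cochain K A M n →ₗ[K] Cochain K A M (n + 1) where
  toFun := B.diff
  map_add' := B.diff_add
  map_smul' := B.diff_smul

end Complex

open CategoryTheory in
/-- The cochain complex `C_PLA(A, M)` of the pre-Lie algebra `A` with coefficients in the bimodule
`B` (with underlying space `M`). It starts in degree `1`: the object with index `n` is the space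
of `(n + 1)`-cochains `Hom (⋀ⁿ A ⊗ A, M)`. -/
noncomputable def Bimodule.complex {K : Type u} {A : Type v} {M : Type w} [Field K]
    [LeftPreLieRing A] [LeftPreLieAlgebra K A] [AddCommGroup M] [Module K M]
    (B : Bimodule K A M) : CochainComplex (ModuleCat.{max v w} K) ℕ :=
  CochainComplex.of (fun n => ModuleCat.of K (Cochain K A M n))
    (fun n => ModuleCat.ofHom (B.diffLin n))
    (fun n => by
      rw [← ModuleCat.ofHom_comp]
      have h : B.diffLin (n + 1) ∘ₗ B.diffLin n = 0 := LinearMap.ext fun f => B.diff_diff f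
      rw [h]
      rfl)

section RotaBaxter

variable {K A : Type*} [Field K] [LeftPreLieRing A] [LeftPreLieAlgebra K A] {lam : K}

/-- The vector space `A` with the product `a ⋆ b = a · T b + T a · b + lam a · b`, see
`StarAlgebra.mul_def`. -/
def StarAlgebra (_T : RBOperator K A lam) : Type _ := A

namespace StarAlgebra

variable (T : RBOperator K A lam)

instance instAddCommGroup : AddCommGroup (StarAlgebra T) := inferInstanceAs (AddCommGroup A)

instance : Module K (StarAlgebra T) := inferInstanceAs (Module K A)

/-- The identity map from `(A, ⋆)` to `A`. -/
def toBase : StarAlgebra T ≃ₗ[K] A := LinearEquiv.refl K A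

instance : Mul (StarAlgebra T) where
  mul a b := (toBase T).symm (toBase T a * T.op (toBase T b) + T.op (toBase T a) * toBase T b
    + lam • (toBase T a * toBase T b))

theorem mul_def (a b : StarAlgebra T) :
    toBase T (a * b) = toBase T a * T.op (toBase T b) + T.op (toBase T a) * toBase T b
      + lam • (toBase T a * toBase T b) := rfl

/-- The map `T` is multiplicative from `(A, ⋆)` to `A`. -/
theorem op_mul (a b : StarAlgebra T) :
    T.op (toBase T (a * b)) = T.op (toBase T a) * T.op (toBase T b) := by
  rw [mul_def, ← T.rota_baxter]

instance : NonUnitalNonAssocRing (StarAlgebra T) where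
  toAddCommGroup := instAddCommGroup T
  mul a b := a * b
  left_distrib a b c := (toBase T).injective (by
    simp only [mul_def, map_add, mul_add, smul_add]; abel)
  right_distrib a b c := (toBase T).injective (by
    simp only [mul_def, map_add, add_mul, smul_add]; abel)
  zero_mul a := (toBase T).injective (by simp [mul_def])
  mul_zero a := (toBase T).injective (by simp [mul_def])

instance : LeftPreLieRing (StarAlgebra T) where
  assoc_symm' a b c := (toBase T).injective (by
    have h := LeftPreLieRing.assoc_symm (L := A)
    simp only [associator] at h ⊢
    have h1 := h (T.op (toBase T a)) (T.op (toBase T b)) (toBase T c)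
    have h2 := h (T.op (toBase T a)) (toBase T b) (T.op (toBase T c))
    have h3 := h (toBase T a) (T.op (toBase T b)) (T.op (toBase T c))
    have h4 := congrArg (lam • ·) (h (toBase T a) (toBase T b) (T.op (toBase T c)))
    have h5 := congrArg (lam • ·) (h (toBase T a) (T.op (toBase T b)) (toBase T c))
    have h6 := congrArg (lam • ·) (h (T.op (toBase T a)) (toBase T b) (toBase T c))
    have h7 := congrArg (lam • lam • ·) (h (toBase T a) (toBase T b) (toBase T c))
    simp only [map_sub, mul_def T (_ * _), mul_def T _ (_ * _), op_mul]
    simp only [mul_def, mul_add, add_mul, smul_mul_assoc, mul_smul_comm, smul_add, smul_sub]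
      at h1 h2 h3 h4 h5 h6 h7 ⊢
    linear_combination (norm := module) h1 + h2 + h3 + h4 + h5 + h6 + h7)

instance : LeftPreLieAlgebra K (StarAlgebra T) where
  smul_assoc c a b := (toBase T).injective (by
    simp only [smul_eq_mul, mul_def, map_smul, smul_mul_assoc, smul_add, smul_comm c])
  smul_comm c a b := (toBase T).injective (by
    simp only [smul_eq_mul, mul_def, map_smul, mul_smul_comm, smul_add, smul_comm c])

end StarAlgebra

variable {T : RBOperator K A lam} {M : Type*} [AddCommGroup M] [Module K M]

/-- The bimodule over `(A, ⋆)` with underlying space `M` and actions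
`a ▷ m = T a · m - T_M (a · m)` and `m ◁ a = m · T a - T_M (m · a)`. -/
def RBBimodule.starBimodule (B : RBBimodule T M) : Bimodule K (StarAlgebra T) M where
  left := LinearMap.mk₂ K
    (fun a m => B.left (T.op (StarAlgebra.toBase T a)) m
      - B.opM (B.left (StarAlgebra.toBase T a) m))
    (fun a a' m => by simp only [map_add, LinearMap.add_apply]; abel)
    (fun c a m => by simp only [map_smul, LinearMap.smul_apply, smul_sub])
    (fun a m m' => by simp only [map_add]; abel)
    (fun c a m => by simp only [map_smul, smul_sub])
  right := LinearMap.mk₂ K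
    (fun m a => B.right m (T.op (StarAlgebra.toBase T a))
      - B.opM (B.right m (StarAlgebra.toBase T a)))
    (fun a a' m => by simp only [map_add, LinearMap.add_apply]; abel)
    (fun c a m => by simp only [map_smul, LinearMap.smul_apply, smul_sub])
    (fun a m m' => by simp only [map_add]; abel)
    (fun c a m => by simp only [map_smul, smul_sub])
  left_left a b m := by
    simp only [LinearMap.mk₂_apply, StarAlgebra.op_mul]
    simp only [StarAlgebra.mul_def]
    generalize StarAlgebra.toBase T a = a
    generalize StarAlgebra.toBase T b = b
    have h1 := B.rota_baxter_left a (B.left b m)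
    have h2 := B.rota_baxter_left b (B.left a m)
    have h3 := B.left_left (T.op a) (T.op b) m
    have h4 := congrArg B.opM (B.left_left a (T.op b) m)
    have h5 := congrArg B.opM (B.left_left (T.op a) b m)
    have h6 := congrArg (fun z => B.opM (lam • z)) (B.left_left a b m)
    simp only [map_add, map_sub, map_smul, LinearMap.add_apply, LinearMap.smul_apply, smul_sub]
      at h1 h2 h3 h4 h5 h6 ⊢
    linear_combination (norm := module) h3 - h4 - h5 - h6 - h1 + h2
  left_right a b m := by
    simp only [LinearMap.mk₂_apply, StarAlgebra.op_mul]
    simp only [StarAlgebra.mul_def]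
    generalize StarAlgebra.toBase T a = a
    generalize StarAlgebra.toBase T b = b
    have h1 := B.rota_baxter_left a (B.right m b)
    have h2 := B.rota_baxter_right b (B.left a m)
    have h2' := B.rota_baxter_right b (B.right m a)
    have h3 := B.left_right (T.op a) (T.op b) m
    have h4 := congrArg B.opM (B.left_right a (T.op b) m)
    have h5 := congrArg B.opM (B.left_right (T.op a) b m)
    have h6 := congrArg (fun z => B.opM (lam • z)) (B.left_right a b m)
    simp only [map_add, map_sub, map_smul, LinearMap.sub_apply, smul_sub] at h1 h2 h2' h3 h4 h5 h6 ⊢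
    linear_combination (norm := module) h3 - h4 - h5 - h6 - h1 + h2 - h2'

@[simp]
theorem RBBimodule.starBimodule_left (B : RBBimodule T M) (a : StarAlgebra T) (m : M) :
    B.starBimodule.left a m = B.left (T.op (StarAlgebra.toBase T a)) m
      - B.opM (B.left (StarAlgebra.toBase T a) m) := rfl

@[simp]
theorem RBBimodule.starBimodule_right (B : RBBimodule T M) (m : M) (a : StarAlgebra T) :
    B.starBimodule.right m a = B.right m (T.op (StarAlgebra.toBase T a))
      - B.opM (B.right m (StarAlgebra.toBase T a)) := rfl

/-- For linear maps `a b : V → W`, the map that sends an alternating map `f` on `W` to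
`f ∘ ∑ (b ∧ ⋯ ∧ a ∧ ⋯ ∧ a ∧ ⋯ ∧ b)`, where the sum is over all ways to choose the `k` positions
(forming the set `s`) of the factor `a` among the `n` positions. -/
def insertSum {V W N : Type*} [AddCommGroup V] [Module K V] [AddCommGroup W] [Module K W]
    [AddCommGroup N] [Module K N] (a b : V →ₗ[K] W) (k : ℕ) {n : ℕ} (f : W [⋀^Fin n]→ₗ[K] N) :
    V [⋀^Fin n]→ₗ[K] N where
  toMultilinearMap := ∑ s ∈ (univ : Finset (Fin n)).powersetCard k,
    f.toMultilinearMap.compLinearMap (fun i => if i ∈ s then a else b)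
  map_eq_zero_of_eq' := by
    intro v i j hv hij
    suffices h : ∑ s ∈ (univ : Finset (Fin n)).powersetCard k,
        f (fun i => (if i ∈ s then a else b) (v i)) = 0 by simpa using h
    have hsw : ∀ l, v (Equiv.swap i j l) = v l := by
      intro l
      by_cases h1 : l = i
      · subst h1; simp [hv]
      · by_cases h2 : l = j
        · subst h2; simp [hv]
        · rw [Equiv.swap_apply_of_ne_of_ne h1 h2]
    have key : ∀ s : Finset (Fin n),
        f (fun l => (if l ∈ s.map (Equiv.swap i j).toEmbedding then a else b) (v l))
          = -f (fun l => (if l ∈ s then a else b) (v l)) := by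
      intro s
      rw [← f.map_swap _ hij]
      congr 1
      funext l
      simp [Finset.mem_map_equiv, hsw]
    refine Finset.sum_involution (fun s _ => s.map (Equiv.swap i j).toEmbedding) ?_ ?_ ?_ ?_
    · intro s _
      rw [key, add_neg_cancel]
    · intro s _ hne heq
      apply hne
      have hmem : i ∈ s ↔ j ∈ s := by
        conv_lhs => rw [← heq]
        simp [Finset.mem_map_equiv]
      refine f.map_eq_zero_of_eq _ ?_ hij
      simp only [hmem, hv]
    · intro s hs
      simpa [Finset.mem_powersetCard] using hs
    · intro s _
      ext l
      simp [Finset.mem_map_equiv]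

theorem alternating_sum_apply {V N ι : Type*} [AddCommGroup V] [Module K V] [AddCommGroup N]
    [Module K N] {n : ℕ} (s : Finset ι) (f : ι → V [⋀^Fin n]→ₗ[K] N) (x : Fin n → V) :
    (∑ k ∈ s, f k) x = ∑ k ∈ s, f k x := by
  classical
  induction s using Finset.induction_on with
  | empty => simp
  | insert a s ha ih => simp [Finset.sum_insert ha, ih]

theorem insertSum_apply {V W N : Type*} [AddCommGroup V] [Module K V] [AddCommGroup W]
    [Module K W] [AddCommGroup N] [Module K N] (a b : V →ₗ[K] W) (k : ℕ) {n : ℕ}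
    (f : W [⋀^Fin n]→ₗ[K] N) (x : Fin n → V) :
    insertSum a b k f x = ∑ s ∈ (univ : Finset (Fin n)).powersetCard k,
      f (fun i => if i ∈ s then a (x i) else b (x i)) := by
  have : ∀ (s : Finset (Fin n)) (i : Fin n),
      (if i ∈ s then a else b) (x i) = if i ∈ s then a (x i) else b (x i) := by
    intro s i; split_ifs <;> rfl
  simp only [← this]
  simp [insertSum]

/-- The map `Φ` from the `(n + 1)`-cochains of `A` with values in `M` to the `(n + 1)`-cochains of
`(A, ⋆)` with values in `M`; it is spelled out on elements in `RBBimodule.phi_apply`. -/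
def RBBimodule.phi (B : RBBimodule T M) (n : ℕ) :
    Cochain K A M n →ₗ[K] Cochain K (StarAlgebra T) M n :=
  let e : StarAlgebra T →ₗ[K] A := (StarAlgebra.toBase T : StarAlgebra T →ₗ[K] A)
  let t : StarAlgebra T →ₗ[K] A := T.op ∘ₗ e
  { toFun := fun f =>
      (LinearMap.lcomp K M t).compAlternatingMap (f.compLinearMap t)
      - ∑ k ∈ Icc 1 (n + 1), lam ^ (n + 1 - k) •
          (B.opM.compRight K ∘ₗ LinearMap.lcomp K M e).compAlternatingMap
            (insertSum t e (k - 1) f)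
      - ∑ k ∈ Icc 2 (n + 1), lam ^ (n + 1 - k) •
          (B.opM.compRight K ∘ₗ LinearMap.lcomp K M t).compAlternatingMap
            (insertSum t e (k - 2) f)
    map_add' := fun f g => by
      ext x y
      simp [alternating_sum_apply, insertSum_apply, Finset.sum_add_distrib, smul_add]
      abel
    map_smul' := fun c f => by
      ext x y
      simp [alternating_sum_apply, insertSum_apply, Finset.smul_sum, smul_sub, smul_comm c] }

theorem RBBimodule.phi_apply (B : RBBimodule T M) (n : ℕ) (f : Cochain K A M n)
    (x : Fin n → A) (y : A) :
    B.phi n f (fun i => (StarAlgebra.toBase T).symm (x i)) ((StarAlgebra.toBase T).symm y) =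
      f (fun i => T.op (x i)) (T.op y)
      - ∑ k ∈ Icc 1 (n + 1), lam ^ (n + 1 - k) •
          ∑ s ∈ (univ : Finset (Fin n)).powersetCard (k - 1),
            B.opM (f (fun i => if i ∈ s then T.op (x i) else x i) y)
      - ∑ k ∈ Icc 2 (n + 1), lam ^ (n + 1 - k) •
          ∑ s ∈ (univ : Finset (Fin n)).powersetCard (k - 2),
            B.opM (f (fun i => if i ∈ s then T.op (x i) else x i) (T.op y)) := by
  simp [RBBimodule.phi, alternating_sum_apply, insertSum_apply, Function.comp_def]

end RotaBaxter

/-- The cochain complex `C_RBO(A, M)` of the Rota-Baxter operator `T` with coefficients in the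
Rota-Baxter bimodule `B`. -/
noncomputable def RBBimodule.rboComplex {K : Type u} {A : Type v} {M : Type w} [Field K]
    [LeftPreLieRing A] [LeftPreLieAlgebra K A] [AddCommGroup M] [Module K M] {lam : K}
    {T : RBOperator K A lam} (B : RBBimodule T M) : CochainComplex (ModuleCat.{max v w} K) ℕ :=
  B.starBimodule.complex

end RotaBaxterPreLie

namespace RotaBaxterPreLie

/-! ### Words in two linear maps and their binomial expansion. -/

section InsertSum

variable {K V W N : Type*} [Field K] [AddCommGroup V] [Module K V] [AddCommGroup W] [Module K W]
  [AddCommGroup N] [Module K N]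

/-! Write `i_a` for `curryLeft` at `a`, `L_a` for `lieDer a`, `d` for `diff`. Cartan's formula `i_a
d = L_a - d i_a` determines `d` recursively, since a cochain with at least one alternating slot is
known once all its contractions are. So a map commutes with `d` as soon as it is compatible with `i`
and `L`, by induction on the number of alternating slots.

Both `T` and `T + lam` are homomorphisms from `(A, ⋆)` to `A`. Summing the words in `Φ` shows that
`Φ f` is `f ∘ T^⊗` minus `T_M` applied to the divided difference "`((T + lam)^⊗ - T^⊗) / lam`" of
`f`, taken over all slots; as a polynomial in `lam` this makes sense also for `lam = 0`. Peeling off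
one slot of the divided difference leaves the auxiliary map `Ψ f = T_M ∘ f ∘ (T + lam)^⊗` (`psi`),
and gives `i_a Φ = Φ i_{Ta} - Ψ i_a` (`curryLeft_phi`) and `i_a Ψ = Ψ i_{(T + lam)a}`
(`curryLeft_psi`). The Lie derivatives obey the same rules (`lieDer_phi`, `lieDer_psi`). Hence `Ψ`
commutes with `d`, and then `i_a d Φ = L_a Φ - d i_a Φ = Φ (L_{Ta} - d i_{Ta}) - Ψ (L_a - d i_a) = Φ
i_{Ta} d - Ψ i_a d = i_a Φ d`. -/

theorem alternating_ext_curryLeft {n : ℕ} {f g : V [⋀^Fin (n + 1)]→ₗ[K] N}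
    (h : ∀ v, f.curryLeft v = g.curryLeft v) : f = g := by
  ext1 x
  have := congrArg (fun F => F (Matrix.vecTail x)) (h (Matrix.vecHead x))
  simpa using this

theorem sum_powersetCard_univ_zero {n : ℕ} (g : Finset (Fin n) → N) :
    ∑ s ∈ (univ : Finset (Fin n)).powersetCard 0, g s = g ∅ := by
  simp

theorem sum_powersetCard_univ_succ {n k : ℕ} (g : Finset (Fin (n + 1)) → N) :
    ∑ s ∈ (univ : Finset (Fin (n + 1))).powersetCard (k + 1), g s =
      ∑ s ∈ (univ : Finset (Fin n)).powersetCard k, g (insert 0 (s.map (Fin.succEmb n)))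
      + ∑ s ∈ (univ : Finset (Fin n)).powersetCard (k + 1), g (s.map (Fin.succEmb n)) := by
  have h0 : (0 : Fin (n + 1)) ∉ (univ : Finset (Fin n)).map (Fin.succEmb n) := by simp
  have hu : (univ : Finset (Fin (n + 1))) =
      insert 0 ((univ : Finset (Fin n)).map (Fin.succEmb n)) := by
    rw [Fin.univ_succ, cons_eq_insert]
    rfl
  rw [hu, powersetCard_succ_insert h0, sum_union, add_comm, sum_image]
  · simp [powersetCard_map]
  · intro s hs s' hs' h
    have hs := fun hm => h0 ((mem_powersetCard.1 hs).1 hm)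
    have hs' := fun hm => h0 ((mem_powersetCard.1 hs').1 hm)
    rw [← erase_insert hs, h, erase_insert hs']
  · rw [disjoint_left]
    intro s hs hs'
    obtain ⟨s', -, rfl⟩ := mem_image.1 hs'
    exact h0 ((mem_powersetCard.1 hs).1 (mem_insert_self _ _))

theorem curryLeft_insertSum_zero (a b : V →ₗ[K] W) {n : ℕ} (f : W [⋀^Fin (n + 1)]→ₗ[K] N)
    (v : V) : (insertSum a b 0 f).curryLeft v = insertSum a b 0 (f.curryLeft (b v)) := by
  ext1 x
  simp only [AlternatingMap.curryLeft_apply_apply, insertSum_apply, sum_powersetCard_univ_zero]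
  congr 1
  funext i
  refine Fin.cases ?_ (fun i => ?_) i <;> simp

/-- Pascal's rule: the first slot carries either `a`, which uses up one of the `k + 1` chosen
positions, or `b`. -/
theorem curryLeft_insertSum_succ (a b : V →ₗ[K] W) (k : ℕ) {n : ℕ}
    (f : W [⋀^Fin (n + 1)]→ₗ[K] N) (v : V) :
    (insertSum a b (k + 1) f).curryLeft v =
      insertSum a b k (f.curryLeft (a v)) + insertSum a b (k + 1) (f.curryLeft (b v)) := by
  ext1 x
  simp only [AlternatingMap.curryLeft_apply_apply, AlternatingMap.add_apply, insertSum_apply,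
    sum_powersetCard_univ_succ]
  congr 1 <;>
  · refine sum_congr rfl fun s _ => ?_
    congr 1
    funext i
    refine Fin.cases ?_ (fun i => ?_) i <;> simp

theorem insertSum_eq_zero (a b : V →ₗ[K] W) {k n : ℕ} (h : n < k) (f : W [⋀^Fin n]→ₗ[K] N) :
    insertSum a b k f = 0 := by
  ext1 x
  rw [insertSum_apply, powersetCard_eq_empty.2 (by simpa using h), sum_empty]
  rfl

theorem curryLeft_sum_smul {ι : Type*} {n : ℕ} (s : Finset ι) (c : ι → K)
    (f : ι → V [⋀^Fin (n + 1)]→ₗ[K] N) (v : V) :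
    (∑ k ∈ s, c k • f k).curryLeft v = ∑ k ∈ s, c k • (f k).curryLeft v := by
  ext1 x
  simp [alternating_sum_apply]

theorem insertSum_add (a b : V →ₗ[K] W) (k : ℕ) {n : ℕ} (f g : W [⋀^Fin n]→ₗ[K] N) :
    insertSum a b k (f + g) = insertSum a b k f + insertSum a b k g := by
  ext1 x
  simp [insertSum_apply, sum_add_distrib]

theorem insertSum_smul (a b : V →ₗ[K] W) (k : ℕ) {n : ℕ} (c : K) (f : W [⋀^Fin n]→ₗ[K] N) :
    insertSum a b k (c • f) = c • insertSum a b k f := by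
  ext1 x
  simp [insertSum_apply, smul_sum]

/-- The binomial expansion of `f ∘ (a + c • b)^{⊗ n}`. -/
theorem sum_insertSum (a b : V →ₗ[K] W) (c : K) {n : ℕ} (f : W [⋀^Fin n]→ₗ[K] N) :
    ∑ j ∈ range (n + 1), c ^ (n - j) • insertSum a b j f = f.compLinearMap (a + c • b) := by
  induction n with
  | zero =>
    ext1 x
    simp [insertSum_apply]
    congr 1
    exact Subsingleton.elim _ _
  | succ n ih =>
    refine alternating_ext_curryLeft fun v => ?_
    have h : (f.compLinearMap (a + c • b)).curryLeft v
        = (f.curryLeft (a v) + c • f.curryLeft (b v)).compLinearMap (a + c • b) := by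
      rw [← map_smul, ← map_add]
      exact AlternatingMap.curryLeft_compLinearMap _ _ _
    rw [h, ← ih, curryLeft_sum_smul, sum_range_succ']
    simp only [curryLeft_insertSum_zero, curryLeft_insertSum_succ, smul_add, sum_add_distrib,
      insertSum_add, insertSum_smul, Nat.add_sub_add_right, add_assoc]
    congr 1
    -- The terms whose first letter is `b`, including the separate one with `j = 0`, form one sum
    -- over `j ≤ n + 1`; its top term asks for `n + 1` letters `a` in `n` slots and vanishes.
    have hs := sum_range_succ' (fun j => c ^ (n + 1 - j) • insertSum a b j (f.curryLeft (b v)))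
      (n + 1)
    simp only [Nat.add_sub_add_right] at hs
    rw [← hs, sum_range_succ, insertSum_eq_zero a b (Nat.lt_succ_self n), smul_zero, add_zero]
    refine sum_congr rfl fun j hj => ?_
    rw [Nat.succ_sub (Nat.lt_succ_iff.1 (mem_range.1 hj)), pow_succ, mul_smul]

/-- The sum of all composites of `f` with words in `a` and `b` that have at least one factor
`b`, where a word with `m` factors `b` has the coefficient `c ^ (m - 1)`. Its product with `c` is
`f ∘ (a + c • b)^{⊗ n} - f ∘ a^{⊗ n}`. -/
def dividedDiff (a b : V →ₗ[K] W) (c : K) {n : ℕ} (f : W [⋀^Fin n]→ₗ[K] N) :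
    V [⋀^Fin n]→ₗ[K] N :=
  ∑ j ∈ range n, c ^ (n - 1 - j) • insertSum a b j f

/-- If the first letter is `a`, the rest must still contain a `b`. If it is `b`, the rest is an
arbitrary word, and since the first `b` carries no factor `c`, the rest is weighted exactly as in
the expansion of `(a + c • b)^⊗`. -/
theorem curryLeft_dividedDiff (a b : V →ₗ[K] W) (c : K) {n : ℕ} (f : W [⋀^Fin (n + 1)]→ₗ[K] N)
    (v : V) : (dividedDiff a b c f).curryLeft v = dividedDiff a b c (f.curryLeft (a v))
      + (f.curryLeft (b v)).compLinearMap (a + c • b) := by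
  rw [← sum_insertSum, dividedDiff, dividedDiff, curryLeft_sum_smul, sum_range_succ',
    sum_range_succ' (fun j => c ^ (n - j) • insertSum a b j (f.curryLeft (b v)))]
  simp only [curryLeft_insertSum_zero, curryLeft_insertSum_succ, smul_add, sum_add_distrib,
    Nat.add_sub_cancel, Nat.sub_zero, add_assoc, Nat.sub_sub, Nat.add_comm]

end InsertSum

namespace RBBimodule

variable {K A M : Type*} [Field K] [LeftPreLieRing A] [LeftPreLieAlgebra K A] {lam : K}
  {T : RBOperator K A lam} [AddCommGroup M] [Module K M]

open RotaBaxterPreLie.StarAlgebra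

/-! ### The two homomorphisms `T` and `T + lam` from `(A, ⋆)` to `A`. -/

variable (T) in
/-- The map `T + lam`. -/
def shift : StarAlgebra T →ₗ[K] A :=
  T.op ∘ₗ (toBase T : StarAlgebra T →ₗ[K] A) + lam • (toBase T : StarAlgebra T →ₗ[K] A)

theorem shift_apply (a : StarAlgebra T) : shift T a = T.op (toBase T a) + lam • toBase T a := rfl

theorem shift_mul (a b : StarAlgebra T) : shift T (a * b) = shift T a * shift T b := by
  rw [shift_apply, op_mul, StarAlgebra.mul_def, shift_apply, shift_apply]
  simp only [add_mul, mul_add, smul_mul_assoc, mul_smul_comm, smul_add]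
  abel

theorem shift_lie (a b : StarAlgebra T) : shift T ⁅a, b⁆ = ⁅shift T a, shift T b⁆ := by
  simp only [Ring.lie_def, map_sub, shift_mul]

theorem op_lie (a b : StarAlgebra T) :
    T.op (toBase T ⁅a, b⁆) = ⁅T.op (toBase T a), T.op (toBase T b)⁆ := by
  simp only [Ring.lie_def, map_sub, op_mul]

/-- A Leibniz rule for the divided difference of the two homomorphisms. Putting the whole weight
term into the second bracket is a choice; it fits the cross terms in `lieDer_phi`. -/
theorem toBase_lie (a b : StarAlgebra T) :
    toBase T ⁅a, b⁆ = ⁅T.op (toBase T a), toBase T b⁆ + ⁅toBase T a, shift T b⁆ := by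
  simp only [Ring.lie_def, map_sub, StarAlgebra.mul_def, shift_apply, mul_add, add_mul, mul_smul_comm,
    smul_mul_assoc]
  abel

/-! ### The maps `psi` and `phi` and their contractions. -/

/-- The map that sends a cochain `f` to `T_M ∘ f ∘ (T + lam)^{⊗ (n + 1)}`. -/
def psi (B : RBBimodule T M) (n : ℕ) : Cochain K A M n →ₗ[K] Cochain K (StarAlgebra T) M n where
  toFun f := (B.opM.compRight K ∘ₗ LinearMap.lcomp K M (shift T)).compAlternatingMap
    (f.compLinearMap (shift T))
  map_add' f g := by ext; simp
  map_smul' c f := by ext; simp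

theorem psi_apply (B : RBBimodule T M) {n : ℕ} (f : Cochain K A M n) (x : Fin n → StarAlgebra T)
    (y : StarAlgebra T) : B.psi n f x y = B.opM (f (fun i => shift T (x i)) (shift T y)) := rfl

/-- With `y` bare in the last slot, the other slots run over all words, so the binomial expansion
gives `(T + lam)^⊗`. With `T y` there, the word with no bare letter is missing, which leaves
`dividedDiff`. -/
theorem phi_apply_eq (B : RBBimodule T M) {n : ℕ} (f : Cochain K A M n)
    (x : Fin n → StarAlgebra T) (y : StarAlgebra T) :
    B.phi n f x y = f (fun i => T.op (toBase T (x i))) (T.op (toBase T y))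
      - B.opM (f (fun i => shift T (x i)) (toBase T y))
      - B.opM (dividedDiff (T.op ∘ₗ (toBase T : StarAlgebra T →ₗ[K] A))
          (toBase T : StarAlgebra T →ₗ[K] A) lam f x (T.op (toBase T y))) := by
  have h := sum_insertSum (T.op ∘ₗ (toBase T : StarAlgebra T →ₗ[K] A))
    (toBase T : StarAlgebra T →ₗ[K] A) lam f
  have h' : f (fun i => shift T (x i)) = (∑ j ∈ range (n + 1), lam ^ (n - j) •
      insertSum (T.op ∘ₗ (toBase T : StarAlgebra T →ₗ[K] A))
        (toBase T : StarAlgebra T →ₗ[K] A) j f) x := by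
    rw [h]; rfl
  rw [h', dividedDiff]
  simp only [phi, LinearMap.coe_mk, AddHom.coe_mk, AlternatingMap.sub_apply, LinearMap.sub_apply,
    alternating_sum_apply, LinearMap.sum_apply, map_sum, AlternatingMap.smul_apply,
    LinearMap.smul_apply, map_smul]
  congr 1
  · congr 1
    rw [range_eq_Ico, sum_Ico_eq_sum_range, ← Ico_add_one_right_eq_Icc, sum_Ico_eq_sum_range]
    refine sum_congr rfl fun j _ => ?_
    rw [show n + 1 - (1 + j) = n - (0 + j) by omega, show 1 + j - 1 = 0 + j by omega]
    rfl
  · rw [range_eq_Ico, sum_Ico_eq_sum_range, ← Ico_add_one_right_eq_Icc, sum_Ico_eq_sum_range]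
    -- Starting at `k = 2` leaves only `n` terms, one fewer than in the first sum; this is the range
    -- of `dividedDiff`.
    refine sum_congr (by simp) fun j _ => ?_
    rw [show n + 1 - (2 + j) = n - 1 - (0 + j) by omega, show 2 + j - 2 = 0 + j by omega]
    rfl

theorem phi_zero_apply (B : RBBimodule T M) (f : Cochain K A M 0) (x : Fin 0 → StarAlgebra T)
    (y : StarAlgebra T) :
    B.phi 0 f x y = f ![] (T.op (toBase T y)) - B.opM (f ![] (toBase T y)) := by
  rw [phi_apply_eq]
  simp [dividedDiff, Subsingleton.elim _ (![] : Fin 0 → A)]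

theorem curryLeft_psi (B : RBBimodule T M) {n : ℕ} (f : Cochain K A M (n + 1))
    (a : StarAlgebra T) : (B.psi (n + 1) f).curryLeft a = B.psi n (f.curryLeft (shift T a)) := by
  ext x y
  simp only [AlternatingMap.curryLeft_apply_apply, psi_apply]
  congr 3
  funext i
  refine Fin.cases ?_ (fun i => ?_) i <;> simp

theorem curryLeft_phi (B : RBBimodule T M) {n : ℕ} (f : Cochain K A M (n + 1))
    (a : StarAlgebra T) : (B.phi (n + 1) f).curryLeft a
      = B.phi n (f.curryLeft (T.op (toBase T a))) - B.psi n (f.curryLeft (toBase T a)) := by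
  ext x y
  have hop : (fun i => T.op (toBase T (Matrix.vecCons a x i)))
      = Matrix.vecCons (T.op (toBase T a)) (fun i => T.op (toBase T (x i))) := by
    funext i
    refine Fin.cases ?_ (fun i => ?_) i <;> simp
  have hsh : (fun i => shift T (Matrix.vecCons a x i))
      = Matrix.vecCons (shift T a) (fun i => shift T (x i)) := by
    funext i
    refine Fin.cases ?_ (fun i => ?_) i <;> simp
  have hd := congrArg (fun F => F x) (curryLeft_dividedDiff
    (T.op ∘ₗ (toBase T : StarAlgebra T →ₗ[K] A)) (toBase T : StarAlgebra T →ₗ[K] A) lam f a)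
  simp only [AlternatingMap.curryLeft_apply_apply, AlternatingMap.add_apply] at hd
  have hc : ((f.curryLeft (toBase T a)).compLinearMap (T.op ∘ₗ (toBase T : StarAlgebra T →ₗ[K] A)
      + lam • (toBase T : StarAlgebra T →ₗ[K] A))) x
      = f (Matrix.vecCons (toBase T a) (fun i => shift T (x i))) := rfl
  -- Splitting the head slot `(T + lam)a` yields a term `lam • f (a, …; y)`. Together with `f (a, …;
  -- T y)` from the divided difference it completes the last slot to `(T + lam)y`, as `psi`
  -- requires.
  have hc' := congrArg (fun g => g (fun i => shift T (x i)))
    (f.curryLeft.map_add (T.op (toBase T a)) (lam • toBase T a))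
  simp only [map_smul, AlternatingMap.add_apply, AlternatingMap.smul_apply,
    AlternatingMap.curryLeft_apply_apply, ← shift_apply] at hc'
  simp only [AlternatingMap.curryLeft_apply_apply, AlternatingMap.sub_apply, LinearMap.sub_apply,
    phi_apply_eq, psi_apply, hop, hsh]
  erw [hd, hc]
  rw [hc']
  simp only [shift_apply, LinearMap.add_apply, LinearMap.smul_apply, map_add, map_smul,
    LinearMap.comp_apply, LinearEquiv.coe_coe]
  abel

/-! ### Lie derivatives and the chain map property. -/

/-- The Rota-Baxter identities for `T_M` say `a ▷ T_M m = T_M ((T + lam)a · m)` and `T_M m ◁ a = T_M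
(m · (T + lam)a)`: `T_M` is a bimodule map out of `M` pulled back along `T + lam`. -/
theorem lieDer_psi (B : RBBimodule T M) (a : StarAlgebra T) {n : ℕ} (f : Cochain K A M n) :
    B.starBimodule.lieDer a (B.psi n f) = B.psi n (B.lieDer (shift T a) f) := by
  induction n with
  | zero =>
    ext x y
    have h1 := B.rota_baxter_left (toBase T a) (f ![] (shift T y))
    have h2 := B.rota_baxter_right (toBase T y) (f ![] (shift T a))
    simp only [map_add, map_smul] at h1 h2
    simp only [Bimodule.lieDer_apply, psi_apply, univ_eq_empty, sum_empty, sub_zero,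
      Bimodule.homAction_apply, starBimodule_left, starBimodule_right, shift_mul,
      Subsingleton.elim _ (![] : Fin 0 → A), map_add, map_sub, h1, h2]
    -- The values of `f` are made opaque, so that `T + lam` is expanded only where it acts on `M`
    -- and not inside the arguments of `f`.
    generalize f ![] = φ at *
    generalize φ (shift T a) = p at *
    generalize φ (shift T y) = q at *
    generalize φ (shift T a * shift T y) = r at *
    simp only [shift_apply, map_add, map_smul, LinearMap.add_apply, LinearMap.smul_apply]
    abel
  | succ n ih =>
    refine curryLeft_ext fun b => ?_
    simp only [curryLeft_lieDer, curryLeft_psi, ih, map_sub, shift_lie]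

theorem diff_psi (B : RBBimodule T M) {n : ℕ} (f : Cochain K A M n) :
    B.starBimodule.diff (B.psi n f) = B.psi (n + 1) (B.diff f) := by
  induction n with
  | zero =>
    refine curryLeft_ext fun a => ?_
    rw [curryLeft_diff_zero, curryLeft_psi, curryLeft_diff_zero, lieDer_psi]
  | succ n ih =>
    refine curryLeft_ext fun a => ?_
    rw [curryLeft_diff_succ, curryLeft_psi, curryLeft_psi, curryLeft_diff_succ, lieDer_psi, ih,
      map_sub]

theorem lieDer_shift (B : RBBimodule T M) (a : StarAlgebra T) {n : ℕ} (f : Cochain K A M n) :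
    B.lieDer (shift T a) f
      = B.lieDer (T.op (toBase T a)) f + lam • B.lieDer (toBase T a) f := by
  ext1 x
  simp only [Bimodule.lieDer_apply, AlternatingMap.add_apply, AlternatingMap.smul_apply,
    shift_apply, map_add, map_smul, LinearMap.add_apply, LinearMap.smul_apply, add_lie, smul_lie,
    AlternatingMap.map_update_add, AlternatingMap.map_update_smul, sum_add_distrib, smul_sub,
    smul_sum]
  abel

theorem lieDer_curryLeft_shift (B : RBBimodule T M) (c : A) (b : StarAlgebra T) {n : ℕ}
    (f : Cochain K A M (n + 1)) :
    B.lieDer c (f.curryLeft (shift T b)) = B.lieDer c (f.curryLeft (T.op (toBase T b)))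
      + lam • B.lieDer c (f.curryLeft (toBase T b)) := by
  ext1 x
  simp only [shift_apply, Bimodule.lieDer_apply, AlternatingMap.add_apply,
    AlternatingMap.smul_apply, map_add, map_smul, sum_add_distrib, smul_sub, smul_sum]
  abel

/-- The Rota-Baxter identities for `T_M` enter only without alternating slots; the induction uses
`i_b L_a = L_a i_b - i_{[a,b]}` and the brackets of `⋆`. -/
theorem lieDer_phi (B : RBBimodule T M) (a : StarAlgebra T) {n : ℕ} (f : Cochain K A M n) :
    B.starBimodule.lieDer a (B.phi n f)
      = B.phi n (B.lieDer (T.op (toBase T a)) f) - B.psi n (B.lieDer (toBase T a) f) := by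
  induction n with
  | zero =>
    ext x y
    have h1 := B.rota_baxter_left (toBase T a) (f ![] (toBase T y))
    have h2 := B.rota_baxter_right (toBase T y) (f ![] (toBase T a))
    simp only [map_add, map_smul] at h1 h2
    simp only [Bimodule.lieDer_apply, psi_apply, phi_zero_apply, univ_eq_empty, sum_empty,
      sub_zero, AlternatingMap.sub_apply, LinearMap.sub_apply, Bimodule.homAction_apply,
      starBimodule_left, starBimodule_right, op_mul, Subsingleton.elim _ (![] : Fin 0 → A)]
    simp only [StarAlgebra.mul_def, map_add, map_sub, map_smul, LinearMap.sub_apply, h1, h2,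
      shift_apply, mul_add, mul_smul_comm]
    abel
  | succ n ih =>
    refine curryLeft_ext fun b => ?_
    simp only [curryLeft_lieDer, curryLeft_phi, curryLeft_psi, curryLeft_sub', ih, map_sub,
      Bimodule.lieDer_sub, lieDer_psi, op_lie]
    -- Inside `psi`, one side has `L_{(T + lam)a} i_b + L_a i_{Tb}` and the other `L_{Ta} i_b + L_a
    -- i_{(T + lam)b}`; both contain the same term `lam • L_a i_b`. The bracket terms agree by
    -- `toBase_lie`.
    rw [toBase_lie, lieDer_shift, lieDer_curryLeft_shift]
    simp only [map_add, map_smul]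
    abel

/-- The map `phi` commutes with the differentials. -/
theorem diff_phi (B : RBBimodule T M) {n : ℕ} (f : Cochain K A M n) :
    B.starBimodule.diff (B.phi n f) = B.phi (n + 1) (B.diff f) := by
  induction n with
  | zero =>
    refine curryLeft_ext fun a => ?_
    rw [curryLeft_diff_zero, curryLeft_phi, curryLeft_diff_zero, curryLeft_diff_zero, lieDer_phi]
  | succ n ih =>
    refine curryLeft_ext fun a => ?_
    rw [curryLeft_diff_succ, curryLeft_phi, curryLeft_phi, curryLeft_diff_succ,
      curryLeft_diff_succ, lieDer_phi, Bimodule.diff_sub, ih, diff_psi, map_sub, map_sub]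
    abel

end RBBimodule

end RotaBaxterPreLie

/-! ### The morphism of cochain complexes. -/

open CategoryTheory in
theorem mainTheorem2 {K : Type u} {A : Type v} {M : Type w} [Field K] [CharZero K]
    [LeftPreLieRing A] [LeftPreLieAlgebra K A] [AddCommGroup M] [Module K M] (lam : K)
    (T : RotaBaxterPreLie.RBOperator K A lam) (B : RotaBaxterPreLie.RBBimodule T M) :
    ∃ Φ : B.complex ⟶ B.rboComplex, ∀ n : ℕ, Φ.f n = ModuleCat.ofHom (B.phi n) := by
  have hd (n : ℕ) : B.complex.d n (n + 1) = ModuleCat.ofHom (B.diffLin n) :=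
    CochainComplex.of_d (fun n => ModuleCat.of K (RotaBaxterPreLie.Cochain K A M n))
      (fun n => ModuleCat.ofHom (B.diffLin n)) n
  have hd' (n : ℕ) : B.rboComplex.d n (n + 1) = ModuleCat.ofHom (B.starBimodule.diffLin n) :=
    CochainComplex.of_d
      (fun n => ModuleCat.of K (RotaBaxterPreLie.Cochain K (RotaBaxterPreLie.StarAlgebra T) M n))
      (fun n => ModuleCat.ofHom (B.starBimodule.diffLin n)) n
  refine ⟨CochainComplex.ofHom (fun n => ModuleCat.ofHom (B.phi n)) fun n => ?_, fun n => rfl⟩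
  rw [hd, hd']
  exact congrArg ModuleCat.ofHom (LinearMap.ext fun f => B.diff_phi f)
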